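/- Let $X$ be a finite alphabet and let $T$ be the regular rooted tree whose vertices are the finite words $v\in X^{*}$, ordered by the prefix relation (the root is the empty word and the children of $v$ are the words $vx$, $x\in X$). Let $\mathrm{Aut}(T)$ be the automorphism group of $T$. For $g\in\mathrm{Aut}(T)$ and $v\in X^{*}$ the state $g|_v\in\mathrm{Aut}(T)$ is the unique automorphism with $g(vw)=g(v)\,g|_v(w)$ for all $w\in X^{*}$; $g$ is called finite-state if the set $\{g|_v : v\in X^{*}\}$ is finite. Put $\theta_k(g)=|\{v\in X^{k} : g|_v \text{ acts non-trivially on } X\}|$ for $k\ge 0$. For $n\ge 0$ let $\mathrm{Pol}(n)$ be the subgroup of $\mathrm{Aut}(T)$ of all finite-state automorphisms $g$ whose sequence $\theta_k(g)$ is bounded above by a polynomial in $k$ of degree at most $n$, and let $\mathrm{Pol}(\infty)=\bigcup_{n\ge 0}\mathrm{Pol}(n)$. The elements of $\mathrm{Pol}(0)$, i.e. the finite-state automorphisms $g$ with $\theta_k(g)$ bounded, are called bounded automorphisms. Proposition. Two bounded automorphisms $a,b\in\mathrm{Pol}(0)$ are conjugate in the group $\mathrm{Pol}(\infty)$ if and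 only if they are conjugate in the group $\mathrm{Pol}(0)$. -/

import Mathlib

namespace RootedTree

/-- Automorphisms of the regular rooted tree whose vertices are the words over the alphabet `X`,
ordered by the prefix relation (the empty word is the root, the children of `v` are the words
`v ++ [x]`). It is a group under composition, `(g * h) v = g (h v)`; groups of right actions are
the opposite groups, with the same subgroups and the same conjugacy relation. -/
abbrev AutT (X : Type*) : Type _ :=
  ((· <+: ·) : List X → List X → Prop) ≃r ((· <+: ·) : List X → List X → Prop)

variable {X : Type*}

theorem length_le_apply (g : AutT X) (u : List X) : u.length ≤ (g u).length := by
  induction u using List.reverseRecOn with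
  | nil => simp
  | append_singleton v x ih =>
    have h1 : g v <+: g (v ++ [x]) := g.map_rel_iff.2 (List.prefix_append v [x])
    have h2 : (g v).length ≠ (g (v ++ [x])).length := by
      intro h
      have h3 := g.injective (h1.eq_of_length h)
      have h4 := congrArg List.length h3
      simp at h4
    have h5 := h1.length_le
    simp only [List.length_append, List.length_singleton]
    omega

theorem length_apply (g : AutT X) (u : List X) : (g u).length = u.length := by
  refine le_antisymm ?_ (length_le_apply g u)
  have h := length_le_apply g⁻¹ (g u)
  rwa [RelIso.inv_apply_self] at h

theorem apply_append_drop (g : AutT X) (v w : List X) :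
    g v ++ (g (v ++ w)).drop v.length = g (v ++ w) := by
  obtain ⟨t, ht⟩ : g v <+: g (v ++ w) := g.map_rel_iff.2 (List.prefix_append v w)
  rw [← ht, ← length_apply g v, List.drop_left]

/-- The state (section) `g|_v` of `g` at the vertex `v`: the automorphism with
`g (v ++ w) = g v ++ g|_v w` for all words `w`. -/
def state (g : AutT X) (v : List X) : AutT X where
  toFun w := (g (v ++ w)).drop v.length
  invFun w := (g⁻¹ (g v ++ w)).drop v.length
  left_inv w := by
    simp only [apply_append_drop, RelIso.inv_apply_self, List.drop_left]
  right_inv w := by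
    have h := apply_append_drop g⁻¹ (g v) w
    rw [RelIso.inv_apply_self, length_apply] at h
    simp only [h, RelIso.apply_inv_self]
    rw [← length_apply g v, List.drop_left]
  map_rel_iff' := by
    intro w w'
    simp only [Equiv.coe_fn_mk]
    rw [← List.prefix_append_right_inj (g v), apply_append_drop, apply_append_drop,
      g.map_rel_iff, List.prefix_append_right_inj]

theorem apply_append (g : AutT X) (v w : List X) : g (v ++ w) = g v ++ state g v w :=
  (apply_append_drop g v w).symm

theorem state_eq_of_apply_append {g s : AutT X} {v : List X}
    (h : ∀ w, g (v ++ w) = g v ++ s w) : state g v = s := by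
  ext1 w
  exact List.append_cancel_left ((apply_append g v w).symm.trans (h w))

theorem state_one (v : List X) : state (1 : AutT X) v = 1 :=
  state_eq_of_apply_append fun _ => rfl

theorem state_mul (g h : AutT X) (v : List X) :
    state (g * h) v = state g (h v) * state h v :=
  state_eq_of_apply_append fun w => by
    simp only [RelIso.mul_apply, apply_append]

theorem state_inv (g : AutT X) (v : List X) : state g⁻¹ v = (state g (g⁻¹ v))⁻¹ := by
  have h := state_mul g g⁻¹ v
  rw [mul_inv_cancel, state_one] at h
  exact (inv_eq_of_mul_eq_one_right h.symm).symm

/-- `g` acts non-trivially on the first level of the tree, that is, on the alphabet. -/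
def ActsNontrivially (g : AutT X) : Prop := ∃ x : X, g [x] ≠ [x]

theorem ActsNontrivially.of_mul {g h : AutT X} (H : ActsNontrivially (g * h)) :
    ActsNontrivially g ∨ ActsNontrivially h := by
  by_contra hc
  simp only [ActsNontrivially, not_or, not_exists, not_not] at hc
  obtain ⟨x, hx⟩ := H
  exact hx (by rw [RelIso.mul_apply, hc.2, hc.1])

theorem ActsNontrivially.of_inv {g : AutT X} (H : ActsNontrivially g⁻¹) :
    ActsNontrivially g := by
  by_contra hc
  simp only [ActsNontrivially, not_exists, not_not] at hc
  obtain ⟨x, hx⟩ := H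
  apply hx
  conv_lhs => rw [← hc x]
  exact RelIso.inv_apply_self g [x]

/-- `g` is finite-state: it has finitely many states. -/
def IsFiniteState (g : AutT X) : Prop := (Set.range (state g)).Finite

/-- The vertices of level `k` at which the state of `g` acts non-trivially on the alphabet. -/
def activeSet (g : AutT X) (k : ℕ) : Set (List X) :=
  {v | v.length = k ∧ ActsNontrivially (state g v)}

/-- The activity `θ_k(g)`: the number of words of length `k` at which `g` is active. -/
noncomputable def activity (g : AutT X) (k : ℕ) : ℕ := (activeSet g k).ncard

theorem activeSet_finite [Finite X] (g : AutT X) (k : ℕ) : (activeSet g k).Finite :=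
  (List.finite_length_eq X k).subset fun _ hv => hv.1

theorem activity_one (k : ℕ) : activity (1 : AutT X) k = 0 := by
  have h : activeSet (1 : AutT X) k = ∅ := by
    ext v
    simp [activeSet, state_one, ActsNontrivially]
  rw [activity, h, Set.ncard_empty]

theorem activity_mul_le [Finite X] (g h : AutT X) (k : ℕ) :
    activity (g * h) k ≤ activity g k + activity h k := by
  have hsub : activeSet (g * h) k ⊆ (h⁻¹ : AutT X) '' activeSet g k ∪ activeSet h k := by
    rintro v ⟨hl, hv⟩
    rw [state_mul] at hv
    rcases hv.of_mul with hg | hh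
    · exact Or.inl ⟨h v, ⟨(length_apply h v).trans hl, hg⟩, RelIso.inv_apply_self h v⟩
    · exact Or.inr ⟨hl, hh⟩
  refine (Set.ncard_le_ncard hsub
    (((activeSet_finite g k).image _).union (activeSet_finite h k))).trans ?_
  refine (Set.ncard_union_le _ _).trans ?_
  rw [Set.ncard_image_of_injective _ (h⁻¹).injective]
  exact le_rfl

theorem activity_inv_le [Finite X] (g : AutT X) (k : ℕ) : activity g⁻¹ k ≤ activity g k := by
  have hsub : activeSet g⁻¹ k ⊆ g '' activeSet g k := by
    rintro v ⟨hl, hv⟩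
    rw [state_inv] at hv
    exact ⟨g⁻¹ v, ⟨(length_apply g⁻¹ v).trans hl, hv.of_inv⟩, RelIso.apply_inv_self g v⟩
  refine (Set.ncard_le_ncard hsub ((activeSet_finite g k).image _)).trans ?_
  rw [Set.ncard_image_of_injective _ g.injective]
  exact le_rfl

/-- The group `Pol(n)` of polynomial automata of degree `n`: the finite-state automorphisms
whose activity is bounded by a polynomial of degree (at most) `n`. The elements of `Pol 0` are
the bounded automorphisms. -/
def Pol (X : Type*) [Finite X] (n : ℕ) : Subgroup (AutT X) where
  carrier := {g | IsFiniteState g ∧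
    ∃ P : Polynomial ℝ, P.natDegree ≤ n ∧ ∀ k : ℕ, (activity g k : ℝ) ≤ P.eval (k : ℝ)}
  one_mem' := by
    refine ⟨(Set.finite_singleton (1 : AutT X)).subset ?_, 0, by simp, by simp [activity_one]⟩
    rintro _ ⟨v, rfl⟩
    exact state_one v
  mul_mem' := by
    rintro g h ⟨hg, P, hP, hgP⟩ ⟨hh, Q, hQ, hhQ⟩
    refine ⟨(Set.Finite.image2 (· * ·) hg hh).subset ?_, P + Q,
      (Polynomial.natDegree_add_le P Q).trans (max_le hP hQ), fun k => ?_⟩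
    · rintro _ ⟨v, rfl⟩
      exact ⟨_, ⟨h v, rfl⟩, _, ⟨v, rfl⟩, (state_mul g h v).symm⟩
    · rw [Polynomial.eval_add]
      have h1 : (activity (g * h) k : ℝ) ≤ activity g k + activity h k := by
        exact_mod_cast activity_mul_le g h k
      linarith [hgP k, hhQ k]
  inv_mem' := by
    rintro g ⟨hg, P, hP, hgP⟩
    refine ⟨(hg.image (·⁻¹)).subset ?_, P, hP, fun k => ?_⟩
    · rintro _ ⟨v, rfl⟩
      exact ⟨_, ⟨g⁻¹ v, rfl⟩, (state_inv g v).symm⟩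
    · have h1 : (activity g⁻¹ k : ℝ) ≤ activity g k := by
        exact_mod_cast activity_inv_le g k
      exact h1.trans (hgP k)

theorem Pol.mono [Finite X] {m n : ℕ} (h : m ≤ n) : Pol X m ≤ Pol X n := by
  rintro g ⟨hg, P, hP, hgP⟩
  exact ⟨hg, P, hP.trans h, hgP⟩

/-- The group `Pol(∞)` of polynomial automata, the union of the groups `Pol(n)`. (The finitary
automorphisms, often written `Pol(-1)`, lie in `Pol(0)` and add nothing to the union.) -/
def PolInf (X : Type*) [Finite X] : Subgroup (AutT X) where
  carrier := ⋃ n : ℕ, (Pol X n : Set (AutT X))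
  one_mem' := Set.mem_iUnion.2 ⟨0, (Pol X 0).one_mem⟩
  mul_mem' := by
    intro g h hg hh
    obtain ⟨m, hm⟩ := Set.mem_iUnion.1 hg
    obtain ⟨n, hn⟩ := Set.mem_iUnion.1 hh
    exact Set.mem_iUnion.2 ⟨max m n, (Pol X (max m n)).mul_mem
      (Pol.mono (le_max_left m n) hm) (Pol.mono (le_max_right m n) hn)⟩
  inv_mem' := by
    intro g hg
    obtain ⟨m, hm⟩ := Set.mem_iUnion.1 hg
    exact Set.mem_iUnion.2 ⟨m, (Pol X m).inv_mem hm⟩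

theorem Pol.le_polInf (X : Type*) [Finite X] (n : ℕ) : Pol X n ≤ PolInf X :=
  fun _ hg => Set.mem_iUnion.2 ⟨n, hg⟩

end RootedTree

namespace RootedTree

/-! Let `h ∈ Pol(n)` satisfy `h * a = b * h`. Call a vertex `v` relevant if `a` has a non-trivial
state at `v`, or `b` has one at `h v`. Let `P` be the union of the `a`-orbits of relevant vertices;
it is prefix-closed. Truncating `h` to `P` deletes its action elsewhere, where `a` and `b` have
trivial states, so the truncation still conjugates `a` to `b` (`trunc_saturation_mul`). It remains
to see that it is bounded.

Activity: each level has boundedly many relevant vertices, and `h` has equal states at `v` and `a v`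
when `v` is not relevant. A non-trivial state of `h` thus persists along the orbit until a relevant
vertex is met. By `exists_period_le_of_arc` a long arc of non-trivial states forces a short orbit,
so active vertices of the truncation lie within a fixed number of steps of relevant ones. The orbit
bound rests on polynomial growth: a non-trivial state of `h` cannot recur along two incomparable
words (`prefix_or_prefix_of_state_eq`).

Finiteness of states: along one orbit of vertices only boundedly many states of `a` are non-trivial,
so powers of `a` up to the first return have finitely many states, and `P` has finitely many shapes
below its vertices. -/

/-! ### Calculus of states -/

theorem apply_nil (g : AutT X) : g [] = [] :=
  List.eq_nil_of_length_eq_zero (length_apply g [])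

theorem exists_apply_singleton (g : AutT X) (x : X) : ∃ y, g [x] = [y] :=
  List.length_eq_one_iff.1 (length_apply g [x])

theorem state_nil (g : AutT X) : state g [] = g :=
  state_eq_of_apply_append fun w => by simp [apply_nil]

theorem state_append (g : AutT X) (v w : List X) :
    state g (v ++ w) = state (state g v) w :=
  state_eq_of_apply_append fun u => by
    rw [List.append_assoc, apply_append g v, apply_append (state g v) w, ← List.append_assoc,
      ← apply_append g v]

theorem state_cons (g : AutT X) (x : X) (w : List X) :
    state g (x :: w) = state (state g [x]) w :=
  state_append g [x] w

theorem apply_cons (g : AutT X) (x : X) (w : List X) :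
    g (x :: w) = g [x] ++ state g [x] w :=
  apply_append g [x] w

theorem state_ne_one_of_append {g : AutT X} {v w : List X} (h : state g (v ++ w) ≠ 1) :
    state g v ≠ 1 := by
  intro hv
  rw [state_append, hv, state_one] at h
  exact h rfl

theorem exists_actsNontrivially_of_ne_one {g : AutT X} (h : g ≠ 1) :
    ∃ v, ActsNontrivially (state g v) := by
  by_contra! hc
  apply h
  ext1 v
  simp only [ActsNontrivially, not_exists, not_not] at hc
  change g v = v
  induction v using List.reverseRecOn with
  | nil => exact apply_nil g
  | append_singleton v x ih => rw [apply_append, ih, hc]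

theorem ActsNontrivially.ne_one {g : AutT X} (h : ActsNontrivially g) : g ≠ 1 := by
  rintro rfl
  obtain ⟨x, hx⟩ := h
  exact hx rfl

/-! ### Truncation of an automorphism to a set of vertices -/

open Classical in
/-- The action of `g` in which the permutations of the alphabet at the vertices outside `E`, and
below the first vertex outside `E`, are replaced by the identity. -/
noncomputable def truncFun : AutT X → Set (List X) → List X → List X
  | _, _, [] => []
  | g, E, x :: w =>
    if [] ∈ E then g [x] ++ truncFun (state g [x]) {u | x :: u ∈ E} w else x :: w

theorem truncFun_nil (g : AutT X) (E : Set (List X)) : truncFun g E [] = [] := rfl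

theorem truncFun_cons_of_mem (g : AutT X) {E : Set (List X)} (hE : [] ∈ E) (x : X)
    (w : List X) :
    truncFun g E (x :: w) = g [x] ++ truncFun (state g [x]) {u | x :: u ∈ E} w := by
  rw [truncFun, if_pos hE]

theorem truncFun_of_notMem (g : AutT X) {E : Set (List X)} (hE : [] ∉ E) (w : List X) :
    truncFun g E w = w := by
  cases w with
  | nil => rfl
  | cons x w => rw [truncFun, if_neg hE]

/-- The state of `g * h` at `u` involves `g` at `h u`, so the vertex set for `g` has to be the image
of `E` under `h`. No prefix-closure is needed. -/
theorem truncFun_mul (g h : AutT X) (E : Set (List X)) (w : List X) :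
    truncFun (g * h) E w = truncFun g {u | h⁻¹ u ∈ E} (truncFun h E w) := by
  induction w generalizing g h E with
  | nil => rfl
  | cons x w ih =>
    by_cases hE : [] ∈ E
    · obtain ⟨y, hy⟩ := exists_apply_singleton h x
      have hy' : h⁻¹ [y] = [x] := by rw [← hy, RelIso.inv_apply_self]
      have hE' : [] ∈ {u | h⁻¹ u ∈ E} := by simpa [apply_nil] using hE
      rw [truncFun_cons_of_mem _ hE, truncFun_cons_of_mem _ hE, state_mul, ih, hy,
        List.singleton_append, truncFun_cons_of_mem _ hE', RelIso.mul_apply, hy]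
      congr 3
      ext u
      simp only [Set.mem_ofPred_eq]
      rw [apply_cons h⁻¹, state_inv, hy', List.singleton_append]
    · have hE' : [] ∉ {u | h⁻¹ u ∈ E} := by simpa [apply_nil] using hE
      rw [truncFun_of_notMem _ hE, truncFun_of_notMem _ hE, truncFun_of_notMem _ hE']

theorem truncFun_eq_apply {g : AutT X} {E : Set (List X)} (h : ∀ v ∉ E, state g v = 1)
    (w : List X) : truncFun g E w = g w := by
  induction w generalizing g E with
  | nil => rw [truncFun_nil, apply_nil]
  | cons x w ih =>
    by_cases hE : [] ∈ E
    · rw [truncFun_cons_of_mem _ hE, apply_cons g x w]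
      exact congrArg _ (ih fun v hv => (state_cons g x v).symm.trans (h _ hv))
    · rw [truncFun_of_notMem _ hE, ← state_nil g, h _ hE]
      rfl

theorem truncFun_one (E : Set (List X)) (w : List X) : truncFun 1 E w = w :=
  truncFun_eq_apply (fun v _ => state_one v) w

theorem truncFun_prefix (g : AutT X) (E : Set (List X)) {w w' : List X} (h : w <+: w') :
    truncFun g E w <+: truncFun g E w' := by
  induction w generalizing g E w' with
  | nil => exact List.nil_prefix
  | cons x w ih =>
    obtain ⟨t, rfl⟩ := h
    by_cases hE : [] ∈ E
    · rw [List.cons_append, truncFun_cons_of_mem _ hE, truncFun_cons_of_mem _ hE]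
      exact (List.prefix_append_right_inj _).2 (ih _ _ (List.prefix_append w t))
    · rw [truncFun_of_notMem _ hE, truncFun_of_notMem _ hE]
      exact List.prefix_append _ _

theorem truncFun_inv_truncFun (g : AutT X) (E : Set (List X)) (w : List X) :
    truncFun g⁻¹ {u | g⁻¹ u ∈ E} (truncFun g E w) = w := by
  rw [← truncFun_mul, inv_mul_cancel, truncFun_one]

theorem truncFun_truncFun_inv (g : AutT X) (E : Set (List X)) (w : List X) :
    truncFun g E (truncFun g⁻¹ {u | g⁻¹ u ∈ E} w) = w := by
  have h := truncFun_inv_truncFun g⁻¹ {u | g⁻¹ u ∈ E} w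
  simpa only [inv_inv, Set.mem_ofPred_eq, RelIso.inv_apply_self, Set.ofPred_mem_eq] using h

/-- The truncation of `g` to the set of vertices `E`. -/
noncomputable def trunc (g : AutT X) (E : Set (List X)) : AutT X where
  toFun := truncFun g E
  invFun := truncFun g⁻¹ {u | g⁻¹ u ∈ E}
  left_inv := truncFun_inv_truncFun g E
  right_inv := truncFun_truncFun_inv g E
  map_rel_iff' := by
    intro w w'
    refine ⟨fun h => ?_, truncFun_prefix g E⟩
    have h1 := truncFun_prefix g⁻¹ {u | g⁻¹ u ∈ E} h
    simpa only [Equiv.coe_fn_mk, truncFun_inv_truncFun] using h1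

theorem trunc_mul (g h : AutT X) (E : Set (List X)) :
    trunc (g * h) E = trunc g {u | h⁻¹ u ∈ E} * trunc h E := by
  ext1 w
  exact truncFun_mul g h E w

theorem trunc_eq_self {g : AutT X} {E : Set (List X)} (h : ∀ v ∉ E, state g v = 1) :
    trunc g E = g := by
  ext1 w
  exact truncFun_eq_apply h w

theorem trunc_one (E : Set (List X)) : trunc 1 E = 1 :=
  trunc_eq_self fun v _ => state_one v

theorem trunc_of_notMem (g : AutT X) {E : Set (List X)} (h : [] ∉ E) : trunc g E = 1 := by
  ext1 w
  exact truncFun_of_notMem g h w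

/-- Prefix-closure ensures that once the truncation has stopped above `v`, the set seen from `v` is
empty. -/
theorem truncFun_append (g : AutT X) {E : Set (List X)} (hE : ∀ v w, v ++ w ∈ E → v ∈ E)
    (v w : List X) :
    truncFun g E (v ++ w) = truncFun g E v ++ truncFun (state g v) {u | v ++ u ∈ E} w := by
  induction v generalizing g E with
  | nil => simp [truncFun_nil, state_nil]
  | cons x v ih =>
    by_cases h : [] ∈ E
    · rw [List.cons_append, truncFun_cons_of_mem _ h, truncFun_cons_of_mem _ h,
        ih _ fun v w => hE (x :: v) w, List.append_assoc, state_cons g x v]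
      rfl
    · have h' : [] ∉ {u | x :: v ++ u ∈ E} := fun hx => h (hE [] _ hx)
      rw [truncFun_of_notMem _ h, truncFun_of_notMem _ h, truncFun_of_notMem _ h']

theorem state_trunc (g : AutT X) {E : Set (List X)} (hE : ∀ v w, v ++ w ∈ E → v ∈ E)
    (v : List X) : state (trunc g E) v = trunc (state g v) {u | v ++ u ∈ E} :=
  state_eq_of_apply_append fun w => truncFun_append g hE v w

/-! ### Growth of the set of vertices with non-trivial state -/

/-- The vertices of level `k` at which the state of `g` is non-trivial. -/
def nontrivialSet (g : AutT X) (k : ℕ) : Set (List X) := {v | v.length = k ∧ state g v ≠ 1}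

theorem nontrivialSet_finite [Finite X] (g : AutT X) (k : ℕ) : (nontrivialSet g k).Finite :=
  (List.finite_length_eq X k).subset fun _ hv => hv.1

/-- How far below `v` an active vertex is found depends only on the state at `v`. -/
theorem IsFiniteState.exists_depth {g : AutT X} (hg : IsFiniteState g) :
    ∃ D : ℕ, ∀ v, state g v ≠ 1 →
      ∃ u : List X, u.length < D ∧ ActsNontrivially (state g (v ++ u)) := by
  choose! f hf using fun (s : AutT X) (h : s ≠ 1) => exists_actsNontrivially_of_ne_one h
  obtain ⟨D, hD⟩ := (hg.image fun s => (f s).length).bddAbove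
  refine ⟨D + 1, fun v hv => ⟨f (state g v), Nat.lt_succ_of_le (hD ⟨_, ⟨v, rfl⟩, rfl⟩), ?_⟩⟩
  rw [state_append]
  exact hf _ hv

/-- Every vertex with non-trivial state is the prefix of an active vertex at most a fixed depth
below it, and each level has boundedly many active vertices. -/
theorem exists_ncard_nontrivialSet_le [Finite X] {g : AutT X} (hg : g ∈ Pol X 0) :
    ∃ B : ℕ, ∀ k, (nontrivialSet g k).ncard ≤ B := by
  obtain ⟨hfs, p, hp, hgp⟩ := hg
  obtain ⟨c, rfl⟩ := Polynomial.natDegree_eq_zero.1 (Nat.le_zero.1 hp)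
  obtain ⟨C, hC⟩ := exists_nat_ge c
  have hact : ∀ k, activity g k ≤ C := fun k => by
    have := hgp k
    rw [Polynomial.eval_C] at this
    exact_mod_cast this.trans hC
  obtain ⟨D, hD⟩ := hfs.exists_depth
  refine ⟨D * C, fun k => ?_⟩
  have hsub : nontrivialSet g k ⊆
      ⋃ d ∈ Finset.range D, List.take k '' activeSet g (k + d) := by
    rintro v ⟨hl, hv⟩
    obtain ⟨u, hu, hvu⟩ := hD v hv
    simp only [Set.mem_iUnion, Finset.mem_range]
    exact ⟨u.length, hu, v ++ u, ⟨by simp [hl], hvu⟩, by simp [← hl]⟩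
  have hfin : ∀ d, (List.take k '' activeSet g (k + d)).Finite := fun d =>
    (activeSet_finite g _).image _
  refine (Set.ncard_le_ncard hsub
    ((Finset.range D).finite_toSet.biUnion fun d _ => hfin d)).trans ?_
  refine (Finset.set_ncard_biUnion_le _ _).trans ?_
  refine (Finset.sum_le_card_nsmul _ _ C fun d _ =>
    (Set.ncard_image_le (activeSet_finite g _)).trans (hact _)).trans ?_
  simp

/-! ### Recurrent states and exponential activity -/

theorem exists_polynomial_eval_lt_two_pow (p : Polynomial ℝ) :
    ∃ j : ℕ, p.eval (j : ℝ) < 2 ^ j := by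
  have h : Filter.Tendsto (fun n : ℕ => p.eval (n : ℝ) / 2 ^ n) Filter.atTop (nhds 0) := by
    induction p using Polynomial.induction_on' with
    | add p q hp hq => simpa [add_div] using hp.add hq
    | monomial n c =>
      simpa [mul_div_assoc] using
        (tendsto_pow_const_div_const_pow_of_one_lt n (one_lt_two (α := ℝ))).const_mul c
  obtain ⟨j, hj⟩ := (h.eventually (gt_mem_nhds one_pos)).exists
  exact ⟨j, (div_lt_one (by positivity)).1 hj⟩

theorem flatMap_injective_of_length {α β : Type*} {f : α → List β} (hf : Function.Injective f)
    {L : ℕ} (hL : ∀ x, (f x).length = L) {l l' : List α} (hl : l.length = l'.length)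
    (h : l.flatMap f = l'.flatMap f) : l = l' := by
  induction l generalizing l' with
  | nil => exact (List.eq_nil_of_length_eq_zero hl.symm).symm
  | cons x l ih =>
    cases l' with
    | nil => simp at hl
    | cons y l' =>
      rw [List.flatMap_cons, List.flatMap_cons] at h
      obtain ⟨h1, h2⟩ := List.append_inj h (by rw [hL, hL])
      rw [hf h1, ih (by simpa using hl) h2]

/-- A polynomial automorphism has no non-trivial state that recurs along two incomparable
words. -/
theorem prefix_or_prefix_of_state_eq [Finite X] {n : ℕ} {g : AutT X} (hg : g ∈ Pol X n)
    {v w₁ w₂ : List X} (hv : state g v ≠ 1) (h₁ : state g (v ++ w₁) = state g v)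
    (h₂ : state g (v ++ w₂) = state g v) : w₁ <+: w₂ ∨ w₂ <+: w₁ := by
  by_contra hc
  obtain ⟨-, p, -, hgp⟩ := hg
  obtain ⟨u, hu⟩ := exists_actsNontrivially_of_ne_one hv
  rw [state_append] at h₁ h₂
  -- Two return words of equal length, distinct because `w₁` and `w₂` are incomparable.
  let f : Bool → List X := fun i => if i then w₁ ++ w₂ else w₂ ++ w₁
  have hne : w₁ ++ w₂ ≠ w₂ ++ w₁ := fun he => hc <|
    List.prefix_or_prefix_of_prefix (List.prefix_append w₁ w₂) (he ▸ List.prefix_append w₂ w₁)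
  have hf : Function.Injective f := by
    rintro (_ | _) (_ | _) h
    · rfl
    · exact absurd h.symm hne
    · exact absurd h hne
    · rfl
  have hL : ∀ i, (f i).length = w₁.length + w₂.length := by
    rintro (_ | _)
    · simp [f, add_comm]
    · simp [f]
  have hfs : ∀ i, state (state g v) (f i) = state g v := by
    rintro (_ | _) <;> simp [f, state_append, h₁, h₂]
  have hls : ∀ l : List Bool, state (state g v) (l.flatMap f) = state g v := by
    intro l
    induction l with
    | nil => exact state_nil _
    | cons i l ih => rw [List.flatMap_cons, state_append, hfs, ih]
  have hlen : ∀ l : List Bool, (l.flatMap f).length = l.length * (w₁.length + w₂.length) := by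
    intro l
    induction l with
    | nil => simp
    | cons i l ih => rw [List.flatMap_cons, List.length_append, hL, ih, List.length_cons]; ring
  obtain ⟨j, hj⟩ := exists_polynomial_eval_lt_two_pow
    (p.comp (Polynomial.X * Polynomial.C ((w₁.length + w₂.length : ℕ) : ℝ) +
      Polynomial.C ((v.length + u.length : ℕ) : ℝ)))
  -- The `2 ^ j` concatenations of `j` return words are distinct, of equal length, and each becomes
  -- active after appending `u`.
  have hcard : 2 ^ j ≤ activity g (j * (w₁.length + w₂.length) + (v.length + u.length)) := by
    let F : List.Vector Bool j → List X := fun l => v ++ (l.1.flatMap f ++ u)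
    have hF : Function.Injective F := fun l l' h => by
      have h1 := List.append_cancel_right (List.append_cancel_left h)
      exact Subtype.ext (flatMap_injective_of_length hf hL (l.2.trans l'.2.symm) h1)
    have hsub : Set.range F ⊆
        activeSet g (j * (w₁.length + w₂.length) + (v.length + u.length)) := by
      rintro _ ⟨l, rfl⟩
      refine ⟨?_, ?_⟩
      · simp only [F, List.length_append, hlen, l.2]
        ring
      · simp only [F]
        rw [state_append, state_append, hls]
        exact hu
    have h1 := Set.ncard_le_ncard hsub (activeSet_finite g _)
    rw [← Set.image_univ, Set.ncard_image_of_injective _ hF, Set.ncard_univ,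
      Nat.card_eq_fintype_card, card_vector, Fintype.card_bool] at h1
    exact h1
  have h2 := hgp (j * (w₁.length + w₂.length) + (v.length + u.length))
  have h3 : ((2 : ℝ) ^ j) ≤
      activity g (j * (w₁.length + w₂.length) + (v.length + u.length)) := by
    exact_mod_cast hcard
  simp only [Polynomial.eval_comp, Polynomial.eval_add, Polynomial.eval_mul, Polynomial.eval_X,
    Polynomial.eval_C] at hj
  push_cast at h2 hj h3
  linarith

/-! ### Orbits of vertices -/

theorem pow_apply_eq_iterate (a : AutT X) (i : ℕ) (v : List X) : (a ^ i) v = (⇑a)^[i] v := by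
  induction i with
  | zero => rfl
  | succ i ih => rw [pow_succ', RelIso.mul_apply, ih, Function.iterate_succ_apply']

/-- The size of the orbit of `v` under `a`. -/
noncomputable def period (a : AutT X) (v : List X) : ℕ := Function.minimalPeriod a v

theorem period_pos [Finite X] (a : AutT X) (v : List X) : 0 < period a v := by
  obtain ⟨i, j, hij, h⟩ := (List.finite_length_eq X v.length).exists_lt_map_eq_of_forall_mem
    (f := fun i : ℕ => (a ^ i) v) fun i => length_apply _ v
  apply Function.minimalPeriod_pos_of_mem_periodicPts
  refine ⟨j - i, Nat.sub_pos_of_lt hij, (a ^ i).injective ?_⟩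
  rw [← pow_apply_eq_iterate, ← RelIso.mul_apply, ← pow_add, Nat.add_sub_cancel' hij.le]
  exact h.symm

theorem pow_period_apply (a : AutT X) (v : List X) : (a ^ period a v) v = v := by
  rw [pow_apply_eq_iterate]
  exact Function.iterate_minimalPeriod

theorem period_le_of_pow_apply_eq {a : AutT X} {v : List X} {i : ℕ} (hi : 0 < i)
    (h : (a ^ i) v = v) : period a v ≤ i :=
  Function.IsPeriodicPt.minimalPeriod_le hi (by rwa [pow_apply_eq_iterate] at h)

theorem pow_mod_period_apply (a : AutT X) (v : List X) (i : ℕ) :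
    (a ^ (i % period a v)) v = (a ^ i) v := by
  rw [pow_apply_eq_iterate, pow_apply_eq_iterate]
  exact Function.iterate_mod_minimalPeriod_eq

theorem period_pow_apply [Finite X] (a : AutT X) (v : List X) (i : ℕ) :
    period a ((a ^ i) v) = period a v := by
  rw [pow_apply_eq_iterate]
  exact Function.minimalPeriod_apply_iterate
    (Function.minimalPeriod_pos_iff_mem_periodicPts.1 (period_pos a v)) i

theorem eq_of_pow_apply_eq {a : AutT X} {v : List X} {i j : ℕ} (hi : i < period a v)
    (hj : j < period a v) (h : (a ^ i) v = (a ^ j) v) : i = j := by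
  rw [pow_apply_eq_iterate, pow_apply_eq_iterate] at h
  exact (Function.iterate_eq_iterate_iff_of_lt_minimalPeriod hi hj).1 h

/-- The factor `Nat.card X` would do; the extra `1` keeps the base of the powers below positive when
`X` is empty. -/
theorem period_append_singleton_le [Finite X] (a : AutT X) (u : List X) (x : X) :
    period a (u ++ [x]) ≤ (Nat.card X + 1) * period a u := by
  choose y hy using fun i : ℕ => exists_apply_singleton (state (a ^ i) u) x
  let F : Fin (period a (u ++ [x])) → X × Fin (period a u) := fun i =>
    (y i, ⟨i % period a u, Nat.mod_lt _ (period_pos a u)⟩)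
  have hF : Function.Injective F := fun i j h => by
    simp only [F, Prod.mk.injEq, Fin.mk.injEq] at h
    refine Fin.ext (eq_of_pow_apply_eq i.2 j.2 ?_)
    rw [apply_append, apply_append, hy, hy, h.1, ← pow_mod_period_apply a u i, h.2,
      pow_mod_period_apply]
  have h1 := Nat.card_le_card_of_injective F hF
  rw [Nat.card_prod, Nat.card_fin, Nat.card_fin] at h1
  exact h1.trans (Nat.mul_le_mul_right _ (Nat.le_succ _))

/-! ### Orbits carrying non-trivial states -/

/-- Descend from `u` letter by letter. Whenever the period may grow, the orbit can be followed into
a child of `u` below which the state of `h` at `u` never recurs. This state then leaves `S`, so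
growth happens at most `S.card` times. -/
theorem period_le_of_state_mem [Finite X] (a : AutT X) {h : AutT X}
    (hinc : ∀ v w₁ w₂, state h v ≠ 1 → state h (v ++ w₁) = state h v →
      state h (v ++ w₂) = state h v → w₁ <+: w₂ ∨ w₂ <+: w₁)
    (w u : List X) (S : Finset (AutT X))
    (hS : ∀ i p, u ++ p <+: (a ^ i) (u ++ w) → state h (u ++ p) ∈ S ∧ state h (u ++ p) ≠ 1) :
    period a (u ++ w) ≤ (Nat.card X + 1) ^ S.card * period a u := by
  classical
  obtain ⟨l, hl⟩ : ∃ l, w.length = l := ⟨_, rfl⟩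
  induction l generalizing w u S with
  | zero =>
    rw [List.eq_nil_of_length_eq_zero hl, List.append_nil]
    exact Nat.le_mul_of_pos_left _ (by positivity)
  | succ l ih =>
    obtain ⟨x, w, rfl⟩ := List.exists_cons_of_length_eq_add_one hl
    rw [List.length_cons, Nat.add_right_cancel_iff] at hl
    -- The period is constant on the orbit, so the induction may continue from any orbit point that
    -- passes through `u`.
    have step : ∀ (z : X) (w' : List X) (j : ℕ), w'.length = l →
        (a ^ j) (u ++ x :: w) = u ++ z :: w' → ∀ S' ⊆ S,
        (∀ i p, u ++ [z] ++ p <+: (a ^ i) (u ++ [z] ++ w') → state h (u ++ [z] ++ p) ∈ S') →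
        period a (u ++ x :: w) ≤ (Nat.card X + 1) ^ S'.card * period a (u ++ [z]) := by
      intro z w' j hw' hj S' hS'S hS'
      rw [← period_pow_apply a _ j, hj, ← List.singleton_append, ← List.append_assoc]
      refine ih _ _ _ (fun i p hp => ⟨hS' i p hp, ?_⟩) hw'
      have h1 := hS (i + j) ([z] ++ p)
      rw [pow_add, RelIso.mul_apply, hj, ← List.append_assoc] at h1
      rw [List.append_assoc u [z] w'] at hp
      exact (h1 hp).2
    obtain ⟨y, hy⟩ := exists_apply_singleton (state (a ^ period a u) u) x
    obtain ⟨w', hw', hwl⟩ : ∃ w', (a ^ period a u) (u ++ x :: w) = u ++ y :: w' ∧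
        w'.length = l := by
      refine ⟨state (state (a ^ period a u) u) [x] w, ?_, by rw [length_apply, hl]⟩
      rw [apply_append, pow_period_apply, apply_cons (state _ u), hy, List.singleton_append]
    have mem : ∀ (z : X) (w' : List X) (j : ℕ), (a ^ j) (u ++ x :: w) = u ++ z :: w' →
        ∀ i p, u ++ [z] ++ p <+: (a ^ i) (u ++ [z] ++ w') → state h (u ++ [z] ++ p) ∈ S := by
      intro z w' j hj i p hp
      have h1 := hS (i + j) ([z] ++ p)
      rw [pow_add, RelIso.mul_apply, hj, ← List.append_assoc] at h1
      rw [List.append_assoc u [z] w'] at hp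
      exact (h1 hp).1
    by_cases hxy : y = x
    · refine (step x w 0 hl rfl S subset_rfl (mem x w 0 rfl)).trans (Nat.mul_le_mul_left _ ?_)
      apply period_le_of_pow_apply_eq (period_pos a u)
      rw [apply_append, pow_period_apply, hy, hxy]
    -- The first return to `u` moves the letter `x` to `y ≠ x`. The state at `u` cannot recur below
    -- both children, by `hinc`.
    · have hu := hS 0 [] (by simp)
      rw [List.append_nil] at hu
      have key : ∀ (z : X) (w' : List X) (j : ℕ), w'.length = l →
          (a ^ j) (u ++ x :: w) = u ++ z :: w' →
          (∀ p, state h (u ++ [z] ++ p) ≠ state h u) →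
          period a (u ++ x :: w) ≤ (Nat.card X + 1) ^ S.card * period a u := by
        intro z w' j hwl hj hz
        refine (step z w' j hwl hj (S.erase (state h u)) (Finset.erase_subset _ _)
          fun i p hp => Finset.mem_erase.2 ⟨hz p, mem z w' j hj i p hp⟩).trans ?_
        rw [← Finset.card_erase_add_one hu.1, pow_succ, mul_assoc]
        exact Nat.mul_le_mul_left _ (period_append_singleton_le a u z)
      by_cases hx : ∃ p, state h (u ++ [x] ++ p) = state h u
      · refine key y w' _ hwl hw' fun q hq => ?_
        obtain ⟨p, hp⟩ := hx
        rw [List.append_assoc] at hp hq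
        rcases hinc u _ _ hu.2 hp hq with hpre | hpre
        · exact hxy (List.cons_prefix_cons.1 hpre).1.symm
        · exact hxy (List.cons_prefix_cons.1 hpre).1
      · exact key x w 0 hl rfl (not_exists.1 hx)

/-- The orbits of `a` on which all states of the polynomial automorphism `h` are non-trivial have
bounded size. -/
theorem exists_period_le [Finite X] {n : ℕ} (a : AutT X) {h : AutT X} (hh : h ∈ Pol X n) :
    ∃ M : ℕ, ∀ v, (∀ i : ℕ, state h ((a ^ i) v) ≠ 1) → period a v ≤ M := by
  have hfs : IsFiniteState h := hh.1
  refine ⟨(Nat.card X + 1) ^ hfs.toFinset.card * period a [], fun v hv => ?_⟩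
  refine period_le_of_state_mem a (fun v w₁ w₂ => prefix_or_prefix_of_state_eq hh) v []
    hfs.toFinset fun i p hp => ⟨hfs.mem_toFinset.2 ⟨_, rfl⟩, ?_⟩
  obtain ⟨t, ht⟩ := hp
  rw [List.nil_append] at ht
  exact state_ne_one_of_append (ht ▸ hv i)

theorem exists_period_le_of_arc [Finite X] {n : ℕ} (a : AutT X) {h : AutT X}
    (hh : h ∈ Pol X n) :
    ∃ M : ℕ, ∀ v, (∀ i < M, state h ((a ^ i) v) ≠ 1) → period a v ≤ M := by
  obtain ⟨M, hM⟩ := exists_period_le a hh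
  -- By induction on the word, the parent has period at most `M`, so an arc of this length covers
  -- the whole orbit of the child. The `+ 1` makes the arc non-empty, as the root requires.
  refine ⟨(Nat.card X + 1) * M + 1, fun v hv => ?_⟩
  have hall : ∀ i : ℕ, state h ((a ^ i) v) ≠ 1 := by
    induction v using List.reverseRecOn with
    | nil =>
      intro i
      have := hv 0 (Nat.succ_pos _)
      rwa [apply_nil] at this ⊢
    | append_singleton v x ih =>
      have hv' := ih fun i hi => by
        have := hv i hi
        rw [apply_append] at this
        exact state_ne_one_of_append this
      have hle := (period_append_singleton_le a v x).trans (Nat.mul_le_mul_left _ (hM v hv'))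
      intro i
      rw [← pow_mod_period_apply]
      exact hv _ ((Nat.mod_lt _ (period_pos _ _)).trans_le (hle.trans (Nat.le_succ _)))
  exact (hM v hall).trans (by nlinarith)

/-! ### The conjugator truncated to the orbits of the non-trivial states -/

/-- The vertices at which `a`, or `b` at the image under `h`, has a non-trivial state. -/
def jointSupport (a b h : AutT X) : Set (List X) := {v | state a v ≠ 1 ∨ state b (h v) ≠ 1}

/-- The vertices whose forward orbit under `a` meets `W`. -/
def saturation (a : AutT X) (W : Set (List X)) : Set (List X) := {v | ∃ i : ℕ, (a ^ i) v ∈ W}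

theorem jointSupport_of_append {a b h : AutT X} {v w : List X}
    (hvw : v ++ w ∈ jointSupport a b h) : v ∈ jointSupport a b h := by
  rcases hvw with hvw | hvw
  · exact Or.inl (state_ne_one_of_append hvw)
  · rw [apply_append] at hvw
    exact Or.inr (state_ne_one_of_append hvw)

theorem saturation_of_append {a : AutT X} {W : Set (List X)} (hW : ∀ v w, v ++ w ∈ W → v ∈ W)
    (v w : List X) (hvw : v ++ w ∈ saturation a W) : v ∈ saturation a W := by
  obtain ⟨i, hi⟩ := hvw
  rw [apply_append] at hi
  exact ⟨i, hW _ _ hi⟩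

theorem subset_saturation (a : AutT X) (W : Set (List X)) : W ⊆ saturation a W :=
  fun _ hv => ⟨0, hv⟩

theorem apply_mem_saturation_iff [Finite X] {a : AutT X} {W : Set (List X)} {v : List X} :
    a v ∈ saturation a W ↔ v ∈ saturation a W := by
  constructor
  · rintro ⟨i, hi⟩
    exact ⟨i + 1, by rwa [pow_succ]⟩
  · rintro ⟨i, hi⟩
    refine ⟨i + (period a v - 1), ?_⟩
    rwa [← RelIso.mul_apply, ← pow_succ, add_assoc, Nat.sub_add_cancel (period_pos a v), pow_add,
      RelIso.mul_apply, pow_period_apply]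

/-- Truncate both sides of `h * a = b * h` to the saturation: it is `a`-invariant, and it contains
every vertex where truncation could alter `a` or, via `h`, `b`. -/
theorem trunc_saturation_mul [Finite X] {a b h : AutT X} (hab : h * a = b * h) :
    trunc h (saturation a (jointSupport a b h)) * a =
      b * trunc h (saturation a (jointSupport a b h)) := by
  set P := saturation a (jointSupport a b h)
  have ha : trunc a P = a := trunc_eq_self fun v hv => by
    by_contra hne
    exact hv (subset_saturation _ _ (Or.inl hne))
  have hb : trunc b {u | h⁻¹ u ∈ P} = b := trunc_eq_self fun v hv => by
    by_contra hne
    exact hv (subset_saturation _ _ (Or.inr (by rwa [RelIso.apply_inv_self])))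
  have hP : {u | a⁻¹ u ∈ P} = P := by
    ext u
    rw [Set.mem_ofPred_eq, ← apply_mem_saturation_iff, RelIso.apply_inv_self]
  calc trunc h P * a = trunc h {u | a⁻¹ u ∈ P} * trunc a P := by rw [ha, hP]
    _ = trunc b {u | h⁻¹ u ∈ P} * trunc h P := by rw [← trunc_mul, hab, trunc_mul]
    _ = b * trunc h P := by rw [hb]

theorem state_apply_of_notMem_jointSupport {a b h : AutT X} (hab : h * a = b * h) {v : List X}
    (hv : v ∉ jointSupport a b h) : state h (a v) = state h v := by
  have h1 := congrArg (state · v) hab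
  simp only [jointSupport, Set.mem_ofPred_eq, not_or, not_not] at hv
  simpa only [state_mul, hv.1, hv.2, one_mul, mul_one] using h1

theorem exists_activity_trunc_le [Finite X] {a b h : AutT X} {n : ℕ} (ha : a ∈ Pol X 0)
    (hb : b ∈ Pol X 0) (hh : h ∈ Pol X n) (hab : h * a = b * h) :
    ∃ C : ℕ, ∀ k, activity (trunc h (saturation a (jointSupport a b h))) k ≤ C := by
  obtain ⟨A, hA⟩ := exists_ncard_nontrivialSet_le ha
  obtain ⟨B, hB⟩ := exists_ncard_nontrivialSet_le hb
  obtain ⟨M, hM⟩ := exists_period_le_of_arc a hh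
  refine ⟨M * (A + B), fun k => ?_⟩
  set P := saturation a (jointSupport a b h)
  have hPa : ∀ v w, v ++ w ∈ P → v ∈ P :=
    saturation_of_append fun _ _ => jointSupport_of_append
  have hhit : ∀ v, ActsNontrivially (state (trunc h P) v) →
      ∃ i < M, (a ^ i) v ∈ jointSupport a b h := by
    intro v hv
    have hne := hv.ne_one
    rw [state_trunc h hPa] at hne
    have hvP : v ∈ P := by
      by_contra hvP
      exact hne (trunc_of_notMem _ (by simpa using hvP))
    have hvh : state h v ≠ 1 := fun h1 => hne (by rw [h1, trunc_one])
    by_contra! hc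
    -- With no hit in the first `M` steps, the state of `h` stays constant there. The orbit then has
    -- at most `M` points and misses the joint support altogether, contradicting `hvP`.
    have harc : ∀ i ≤ M, state h ((a ^ i) v) ≠ 1 := by
      intro i
      induction i with
      | zero => exact fun _ => hvh
      | succ i ih =>
        intro hi
        rw [pow_succ', RelIso.mul_apply, state_apply_of_notMem_jointSupport hab (hc i hi)]
        exact ih (Nat.le_of_succ_le hi)
    obtain ⟨i, hi⟩ := hvP
    rw [← pow_mod_period_apply] at hi
    exact hc _ ((Nat.mod_lt _ (period_pos a v)).trans_le (hM v fun i hi => harc i hi.le)) hi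
  have hsub : activeSet (trunc h P) k ⊆ ⋃ i ∈ Finset.range M,
      ((a ^ i)⁻¹ : AutT X) '' (nontrivialSet a k ∪ (h⁻¹ : AutT X) '' nontrivialSet b k) := by
    rintro v ⟨hl, hv⟩
    obtain ⟨i, hiM, hi⟩ := hhit v hv
    simp only [Set.mem_iUnion, Finset.mem_range]
    refine ⟨i, hiM, (a ^ i) v, ?_, RelIso.inv_apply_self _ v⟩
    rcases hi with hi | hi
    · exact Or.inl ⟨by rw [length_apply, hl], hi⟩
    · exact Or.inr ⟨_, ⟨by rw [length_apply, length_apply, hl], hi⟩, RelIso.inv_apply_self h _⟩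
  have hfin : (nontrivialSet a k ∪ (h⁻¹ : AutT X) '' nontrivialSet b k).Finite :=
    (nontrivialSet_finite a k).union ((nontrivialSet_finite b k).image _)
  have hcard : (nontrivialSet a k ∪ (h⁻¹ : AutT X) '' nontrivialSet b k).ncard ≤ A + B :=
    (Set.ncard_union_le _ _).trans (Nat.add_le_add (hA k)
      ((Set.ncard_image_le (nontrivialSet_finite b k)).trans (hB k)))
  refine (Set.ncard_le_ncard hsub
    ((Finset.range M).finite_toSet.biUnion fun i _ => hfin.image _)).trans ?_
  refine (Finset.set_ncard_biUnion_le _ _).trans ?_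
  refine (Finset.sum_le_card_nsmul _ _ (A + B) fun i _ =>
    (Set.ncard_image_le hfin).trans hcard).trans ?_
  simp

/-! ### The truncated conjugator is finite-state -/

-- The state of a power is the product of the states met along the orbit, and trivial factors can be
-- dropped. Including `1` among the factors later allows padding to a uniform exponent.
open scoped Pointwise in
theorem state_pow_mem (a : AutT X) (v : List X) (r : ℕ) :
    state (a ^ r) v ∈ (insert 1 (Set.range (state a))) ^
      {j ∈ Set.Iio r | state a ((a ^ j) v) ≠ 1}.ncard := by
  classical
  induction r with
  | zero => simp [state_one]
  | succ r ih =>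
    have hfin : {j ∈ Set.Iio r | state a ((a ^ j) v) ≠ 1}.Finite :=
      (Set.finite_Iio r).subset fun _ hj => hj.1
    rw [pow_succ', state_mul]
    by_cases hr : state a ((a ^ r) v) = 1
    · have he : {j ∈ Set.Iio (r + 1) | state a ((a ^ j) v) ≠ 1} =
          {j ∈ Set.Iio r | state a ((a ^ j) v) ≠ 1} := by
        ext j
        simp only [Set.mem_ofPred_eq, Set.mem_Iio]
        refine ⟨fun hj => ⟨lt_of_le_of_ne (Nat.le_of_lt_succ hj.1) ?_, hj.2⟩,
          fun hj => ⟨hj.1.trans (Nat.lt_succ_self r), hj.2⟩⟩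
        rintro rfl
        exact hj.2 hr
      rw [he, hr, one_mul]
      exact ih
    · have he : {j ∈ Set.Iio (r + 1) | state a ((a ^ j) v) ≠ 1} =
          insert r {j ∈ Set.Iio r | state a ((a ^ j) v) ≠ 1} := by
        ext j
        simp only [Set.mem_ofPred_eq, Set.mem_Iio, Set.mem_insert_iff]
        refine ⟨fun hj => ?_, ?_⟩
        · rcases (Nat.le_of_lt_succ hj.1).eq_or_lt with h | h
          · exact Or.inl h
          · exact Or.inr ⟨h, hj.2⟩
        · rintro (rfl | hj)
          · exact ⟨Nat.lt_succ_self _, hr⟩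
          · exact ⟨hj.1.trans (Nat.lt_succ_self r), hj.2⟩
      rw [he, Set.ncard_insert_of_notMem (fun hj => lt_irrefl r hj.1) hfin, pow_succ']
      exact Set.mul_mem_mul (Or.inr ⟨_, rfl⟩) ih

/-- The powers of a bounded automorphism, up to the first return to a vertex, have finitely many
states at that vertex. -/
theorem finite_state_pow_le_period [Finite X] {a : AutT X} (ha : a ∈ Pol X 0) :
    {s | ∃ v, ∃ r ≤ period a v, state (a ^ r) v = s}.Finite := by
  classical
  obtain ⟨A, hA⟩ := exists_ncard_nontrivialSet_le ha
  have hfs : IsFiniteState a := ha.1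
  open scoped Pointwise in
  have hfin : ((insert 1 (Set.range (state a))) ^ A : Set (AutT X)).Finite := by
    have h1 : (insert 1 (Set.range (state a))).Finite := hfs.insert 1
    clear hA
    induction A with
    | zero => exact Set.finite_one
    | succ A ih => rw [pow_succ]; exact ih.mul h1
  refine hfin.subset ?_
  rintro _ ⟨v, r, hr, rfl⟩
  refine Set.pow_subset_pow_right (Set.mem_insert _ _) ?_ (state_pow_mem a v r)
  -- Before the first return the orbit points are distinct, so the non-trivial factors are counted
  -- by vertices of a single level.
  refine (Set.ncard_le_ncard_of_injOn (fun j => (a ^ j) v) (t := nontrivialSet a v.length)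
    ?_ ?_ (nontrivialSet_finite a _)).trans (hA _)
  · exact fun j hj => ⟨length_apply _ v, hj.2⟩
  · exact fun i hi j hj h => eq_of_pow_apply_eq (hi.1.trans_le hr) (hj.1.trans_le hr) h

theorem finite_jointSupport_append {a b h : AutT X} (ha : IsFiniteState a)
    (hb : IsFiniteState b) (hh : IsFiniteState h) :
    (Set.range fun v => {w | v ++ w ∈ jointSupport a b h}).Finite := by
  refine ((ha.prod (hb.prod hh)).image fun s : AutT X × AutT X × AutT X =>
    jointSupport s.1 s.2.1 s.2.2).subset ?_
  rintro _ ⟨v, rfl⟩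
  refine ⟨(state a v, state b (h v), state h v), ⟨⟨v, rfl⟩, ⟨h v, rfl⟩, ⟨v, rfl⟩⟩, ?_⟩
  ext w
  simp only [jointSupport, Set.mem_ofPred_eq, apply_append h, ← state_append]

theorem pow_pow_period_apply_append (a : AutT X) (v w : List X) (q : ℕ) :
    (a ^ (period a v * q)) (v ++ w) = v ++ (state (a ^ period a v) v ^ q) w := by
  induction q with
  | zero => rfl
  | succ q ih =>
    rw [Nat.mul_succ, add_comm, pow_add, RelIso.mul_apply, ih, apply_append, pow_period_apply,
      pow_succ', RelIso.mul_apply]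

/-- Write an exponent as `r + period a v * q` with `r < period a v`. The saturation below `v`
depends only on the return state at `v` and on a set of pairs (state of `a ^ r` at `v`, shape of `W`
below `(a ^ r) v`), all drawn from finite sets. -/
theorem finite_saturation_append [Finite X] {a : AutT X} (ha : a ∈ Pol X 0)
    {W : Set (List X)} (hW : (Set.range fun v => {w | v ++ w ∈ W}).Finite) :
    (Set.range fun v => {w | v ++ w ∈ saturation a W}).Finite := by
  have hA := finite_state_pow_le_period ha
  refine (Set.Finite.image2 (fun (c : AutT X) (D : Set (AutT X × Set (List X))) =>
    {w : List X | ∃ q : ℕ, ∃ d ∈ D, d.1 ((c ^ q) w) ∈ d.2}) hA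
    (hA.prod hW).finite_subsets).subset ?_
  rintro _ ⟨v, rfl⟩
  refine ⟨state (a ^ period a v) v, ⟨v, _, le_rfl, rfl⟩,
    (fun r => (state (a ^ r) v, {w | (a ^ r) v ++ w ∈ W})) '' Set.Iio (period a v), ?_, ?_⟩
  · rintro _ ⟨r, hr, rfl⟩
    exact ⟨⟨v, r, le_of_lt hr, rfl⟩, ⟨_, rfl⟩⟩
  · have hpow : ∀ r q w, (a ^ (r + period a v * q)) (v ++ w) =
        (a ^ r) v ++ state (a ^ r) v ((state (a ^ period a v) v ^ q) w) := by
      intro r q w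
      rw [pow_add, RelIso.mul_apply, pow_pow_period_apply_append, apply_append]
    ext w
    constructor
    · rintro ⟨q, _, ⟨r, -, rfl⟩, hd⟩
      exact ⟨r + period a v * q, by rw [hpow]; exact hd⟩
    · rintro ⟨i, hi⟩
      rw [← Nat.mod_add_div i (period a v), hpow] at hi
      exact ⟨i / period a v, _, ⟨i % period a v, Nat.mod_lt _ (period_pos a v), rfl⟩, hi⟩

theorem isFiniteState_trunc {g : AutT X} (hg : IsFiniteState g) {E : Set (List X)}
    (hE : ∀ v w, v ++ w ∈ E → v ∈ E) (hEfin : (Set.range fun v => {w | v ++ w ∈ E}).Finite) :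
    IsFiniteState (trunc g E) := by
  refine (hg.image2 trunc hEfin).subset ?_
  rintro _ ⟨v, rfl⟩
  exact ⟨_, ⟨v, rfl⟩, _, ⟨v, rfl⟩, (state_trunc g hE v).symm⟩

theorem trunc_saturation_mem_pol_zero [Finite X] {a b h : AutT X} {n : ℕ} (ha : a ∈ Pol X 0)
    (hb : b ∈ Pol X 0) (hh : h ∈ Pol X n) (hab : h * a = b * h) :
    trunc h (saturation a (jointSupport a b h)) ∈ Pol X 0 := by
  obtain ⟨C, hC⟩ := exists_activity_trunc_le ha hb hh hab
  refine ⟨isFiniteState_trunc hh.1 (saturation_of_append fun _ _ => jointSupport_of_append)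
    (finite_saturation_append ha (finite_jointSupport_append ha.1 hb.1 hh.1)),
    Polynomial.C (C : ℝ), by simp, fun k => ?_⟩
  rw [Polynomial.eval_C]
  exact_mod_cast hC k

end RootedTree

/-! ### The conjugacy criterion -/

theorem mainTheorem7 {X : Type*} [Finite X] (a b : RootedTree.Pol X 0) :
    IsConj (Subgroup.inclusion (RootedTree.Pol.le_polInf X 0) a)
        (Subgroup.inclusion (RootedTree.Pol.le_polInf X 0) b) ↔
      IsConj a b := by
  refine ⟨fun hconj => ?_, fun hconj => MonoidHom.map_isConj _ hconj⟩
  obtain ⟨⟨h, hh⟩, hab⟩ := isConj_iff.1 hconj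
  obtain ⟨n, hn⟩ := Set.mem_iUnion.1 hh
  have hab' : h * (a : RootedTree.AutT X) = b * h :=
    mul_inv_eq_iff_eq_mul.1 (congrArg Subtype.val hab)
  refine isConj_iff.2
    ⟨⟨_, RootedTree.trunc_saturation_mem_pol_zero a.2 b.2 hn hab'⟩, Subtype.ext ?_⟩
  exact mul_inv_eq_iff_eq_mul.2 (RootedTree.trunc_saturation_mul hab')
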